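/- Let $f=[f_0:f_1:f_2]:\mathbb{P}^2\dashrightarrow\mathbb{P}^2$ be a rational endomorphism of the complex projective plane, where $f_0,f_1,f_2\in\mathbb{C}[x_0,x_1,x_2]$ are homogeneous polynomials of degree $3$ without a common factor, and let $I_f=\{f_0=f_1=f_2=0\}\subset\mathbb{P}^2$ be its indeterminacy locus. Suppose that $\#I_f\ge 7$ and that $f$ is generic in the following sense: the points of $I_f$ are in general position, i.e. no three of them lie on a line and no six of them lie on a conic (a curve of degree $2$, possibly reducible). Then $f$ is not surjective, i.e. the morphism $f:\mathbb{P}^2\setminus I_f\to\mathbb{P}^2$ is not onto. -/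

import Mathlib

open scoped LinearAlgebra.Projectivization

/-- The complex projective plane. -/
abbrev Plane : Type := ℙ ℂ (Fin 3 → ℂ)

/-- Forms (polynomials) in the homogeneous coordinates of the plane. -/
abbrev Form : Type := MvPolynomial (Fin 3) ℂ

/-- The form `F` vanishes at the point `p`. For homogeneous `F` this does not depend on the
vector representing `p`, see `Form.vanishesAt_mk`. -/
def Form.VanishesAt (F : Form) (p : Plane) : Prop :=
  MvPolynomial.eval p.rep F = 0

theorem Form.eval_smul {F : Form} {d : ℕ} (hF : F.IsHomogeneous d) (c : ℂ) (v : Fin 3 → ℂ) :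
    MvPolynomial.eval (c • v) F = c ^ d * MvPolynomial.eval v F := by
  rw [MvPolynomial.eval_eq, MvPolynomial.eval_eq, Finset.mul_sum]
  refine Finset.sum_congr rfl fun m hm => ?_
  have hd : m.degree = d := by
    rw [Finsupp.degree_eq_weight_one]
    exact hF (MvPolynomial.mem_support_iff.mp hm)
  have hd' : ∑ i ∈ m.support, m i = d := hd
  simp only [Pi.smul_apply, smul_eq_mul, mul_pow, Finset.prod_mul_distrib,
    Finset.prod_pow_eq_pow_sum, hd']
  ring

theorem Form.vanishesAt_mk {F : Form} {d : ℕ} (hF : F.IsHomogeneous d) (v : Fin 3 → ℂ)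
    (hv : v ≠ 0) :
    Form.VanishesAt F (Projectivization.mk ℂ v hv) ↔ MvPolynomial.eval v F = 0 := by
  obtain ⟨a, ha⟩ := Projectivization.exists_smul_eq_mk_rep ℂ v hv
  have h : MvPolynomial.eval (Projectivization.mk ℂ v hv).rep F
      = (a : ℂ) ^ d * MvPolynomial.eval v F := by
    rw [← ha]
    exact Form.eval_smul hF (a : ℂ) v
  simp [Form.VanishesAt, h]

/-- A rational endomorphism `[f₀ : f₁ : f₂]` of the plane, given by homogeneous polynomials
of the same degree `d` without a common factor. -/
structure RationalEndo (d : ℕ) where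
  comp : Fin 3 → Form
  homogeneous : ∀ i, (comp i).IsHomogeneous d
  coprime : ∀ g : Form, (∀ i, g ∣ comp i) → IsUnit g

namespace RationalEndo

variable {d : ℕ} (f : RationalEndo d)

/-- The indeterminacy locus `I_f`: the common zeros of the components. -/
def indeterminacyLocus : Set Plane :=
  {p | ∀ i, Form.VanishesAt (f.comp i) p}

theorem value_ne_zero (p : (f.indeterminacyLocusᶜ : Set Plane)) :
    (fun i => MvPolynomial.eval p.1.rep (f.comp i)) ≠ 0 :=
  fun h => p.2 fun i => congrFun h i

/-- The induced morphism `ℙ² \ I_f → ℙ²`. -/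
noncomputable def toMap (p : (f.indeterminacyLocusᶜ : Set Plane)) : Plane :=
  Projectivization.mk ℂ (fun i => MvPolynomial.eval p.1.rep (f.comp i)) (f.value_ne_zero p)

/-- The value at `[v]` is `[f₀(v) : f₁(v) : f₂(v)]`, for every representative `v`. -/
theorem toMap_mk (v : Fin 3 → ℂ) (hv : v ≠ 0)
    (hp : Projectivization.mk ℂ v hv ∈ (f.indeterminacyLocusᶜ : Set Plane))
    (hw : (fun i => MvPolynomial.eval v (f.comp i)) ≠ 0) :
    f.toMap ⟨Projectivization.mk ℂ v hv, hp⟩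
      = Projectivization.mk ℂ (fun i => MvPolynomial.eval v (f.comp i)) hw := by
  obtain ⟨a, ha⟩ := Projectivization.exists_smul_eq_mk_rep ℂ v hv
  rw [toMap, Projectivization.mk_eq_mk_iff']
  refine ⟨(a : ℂ) ^ d, ?_⟩
  funext i
  have h := Form.eval_smul (f.homogeneous i) (a : ℂ) v
  rw [show (a : ℂ) • v = (Projectivization.mk ℂ v hv).rep from ha] at h
  exact h.symm

/-- `f` is surjective if the induced morphism `ℙ² \ I_f → ℙ²` is onto. -/
def IsSurjective : Prop :=
  Function.Surjective f.toMap

end RationalEndo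

/-- A set of points in the plane is in general position if no three of its points lie on a line
and no six of them lie on a conic. -/
def InGeneralPosition (S : Set Plane) : Prop :=
  (∀ L : Form, L ≠ 0 → L.IsHomogeneous 1 → {p ∈ S | Form.VanishesAt L p}.encard ≤ 2) ∧
  (∀ Q : Form, Q ≠ 0 → Q.IsHomogeneous 2 → {p ∈ S | Form.VanishesAt Q p}.encard ≤ 5)

/-!
Choose seven points `p₁, …, p₇` of `I_f`, and suppose that `f` is surjective. The components of `f`
are then linearly independent and span a net of cubics through the seven points. By Euler's formula
the Jacobian matrix of `f` at a point of `I_f` is singular, so the net contains a cubic `F = a · f`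
singular at `p₁` and a cubic `G = b · f` singular at `p₂`. Let `q ≠ 0` satisfy `a · q = b · q = 0`.
A point with value `[q]` is a common zero of `F` and `G` outside `I_f`. But `F` and `G` already meet
with multiplicity at least `2 + 2 + 5 = 9` at the seven points, so a further common zero would force
them to share a component, which general position excludes.

This use of Bézout's theorem is made explicit. In coordinates where `p₁, p₂, p₃` are the coordinate
points, `F = x₀ q₂(x₁, x₂) + x₁ x₂ ℓ(x₁, x₂)` is a rational curve, parametrized by the lines through
`p₁`. Restricting `G` to it and removing the zeros forced by `p₁, p₂, p₃` leaves a polynomial of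
degree at most `4` in the parameter (`residual_quartic_eq_zero`). It vanishes at the parameters of
`p₄, …, p₇` and of any further common zero, and these are distinct; so it is zero. Since `q₂` and `ℓ`
are coprime (`IsGeneralFrame.nodal_resultant_ne_zero`), `G` is zero (`residual_coeff_eq_zero`), a
contradiction.
-/

/-! ### Seven points in general position, in adapted coordinates -/

/-- Seven vectors of `ℂ³`, the first three being the standard basis, that represent points in
general position: a linear form vanishing at three of them is zero, and a quadratic form vanishing
at six of them is zero. The forms are given by their coefficients. -/
structure IsGeneralFrame (y : Fin 7 → Fin 3 → ℂ) : Prop where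
  zero : y 0 = ![1, 0, 0]
  one : y 1 = ![0, 1, 0]
  two : y 2 = ![0, 0, 1]
  line : ∀ l₀ l₁ l₂ : ℂ, ∀ T : Finset (Fin 7), 3 ≤ T.card →
    (∀ i ∈ T, l₀ * y i 0 + l₁ * y i 1 + l₂ * y i 2 = 0) → l₀ = 0 ∧ l₁ = 0 ∧ l₂ = 0
  conic : ∀ q₀₀ q₁₁ q₂₂ q₀₁ q₀₂ q₁₂ : ℂ, ∀ T : Finset (Fin 7), 6 ≤ T.card →
    (∀ i ∈ T, q₀₀ * y i 0 ^ 2 + q₁₁ * y i 1 ^ 2 + q₂₂ * y i 2 ^ 2 + q₀₁ * (y i 0 * y i 1)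
      + q₀₂ * (y i 0 * y i 2) + q₁₂ * (y i 1 * y i 2) = 0) →
    q₀₀ = 0 ∧ q₁₁ = 0 ∧ q₂₂ = 0 ∧ q₀₁ = 0 ∧ q₀₂ = 0 ∧ q₁₂ = 0

namespace IsGeneralFrame

variable {y : Fin 7 → Fin 3 → ℂ} (hy : IsGeneralFrame y)
include hy

theorem coord_one_ne_zero {k : Fin 7} (hk : 3 ≤ k) : y k 1 ≠ 0 := by
  intro h
  have := hy.line 0 1 0 {0, 2, k} (by
    rw [Finset.card_eq_three.mpr ⟨0, 2, k, by decide, by grind, by grind, rfl⟩])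
    (by simp [hy.zero, hy.two, h])
  simp at this

theorem coord_two_ne_zero {k : Fin 7} (hk : 3 ≤ k) : y k 2 ≠ 0 := by
  intro h
  have := hy.line 0 0 1 {0, 1, k} (by
    rw [Finset.card_eq_three.mpr ⟨0, 1, k, by decide, by grind, by grind, rfl⟩])
    (by simp [hy.zero, hy.one, h])
  simp at this

/-- No two of the last four points lie on a common line through the first point; so
`x₂ / x₁`, the parameter of the pencil of lines through the first point, separates them. -/
theorem slope_ne {k l : Fin 7} (hk : 3 ≤ k) (hl : 3 ≤ l) (hkl : k ≠ l) :
    y k 2 / y k 1 ≠ y l 2 / y l 1 := by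
  intro h
  rw [div_eq_div_iff (hy.coord_one_ne_zero hk) (hy.coord_one_ne_zero hl)] at h
  have := hy.line 0 (y k 2) (-y k 1) {0, k, l} (by
    rw [Finset.card_eq_three.mpr ⟨0, k, l, by grind, by grind, hkl, rfl⟩])
    (by
      simp only [Finset.mem_insert, Finset.mem_singleton]
      rintro i (rfl | rfl | rfl)
      · simp [hy.zero]
      · ring
      · linear_combination h)
  exact hy.coord_two_ne_zero hk this.2.1

/-- A cubic through the seven points that is singular at `[1 : 0 : 0]` contains neither of the lines
`x₂ = 0` and `x₁ = 0`: the residual conic would pass through six of the points. -/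
theorem nodal_coeff_ne_zero {A B C α β : ℂ}
    (hne : ¬ (A = 0 ∧ B = 0 ∧ C = 0 ∧ α = 0 ∧ β = 0))
    (hF : ∀ k, 3 ≤ k → y k 0 * (A * y k 1 ^ 2 + B * (y k 1 * y k 2) + C * y k 2 ^ 2)
      + y k 1 * y k 2 * (α * y k 1 + β * y k 2) = 0) :
    A ≠ 0 ∧ C ≠ 0 := by
  constructor
  · rintro rfl
    have := hy.conic 0 α 0 B C β {0, 2, 3, 4, 5, 6} (by decide) (by
      intro i hi
      obtain rfl | rfl | h3 : i = 0 ∨ i = 2 ∨ 3 ≤ i := by revert i; decide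
      · simp [hy.zero]
      · simp [hy.two]
      · apply mul_left_cancel₀ (hy.coord_two_ne_zero h3)
        linear_combination hF i h3)
    grind
  · rintro rfl
    have := hy.conic 0 0 β A B α {0, 1, 3, 4, 5, 6} (by decide) (by
      intro i hi
      obtain rfl | rfl | h3 : i = 0 ∨ i = 1 ∨ 3 ≤ i := by revert i; decide
      · simp [hy.zero]
      · simp [hy.one]
      · apply mul_left_cancel₀ (hy.coord_one_ne_zero h3)
        linear_combination hF i h3)
    grind

/-- For a cubic `x₀ q₂ + x₁ x₂ ℓ` through the seven points, the binary forms `q₂` and `ℓ` in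
`x₁, x₂` have no common zero: the expression is their resultant. If it vanished, the cubic would
split off the line `ℓ = 0` or, if `ℓ = 0` identically, be three lines. -/
theorem nodal_resultant_ne_zero {A B C α β : ℂ} (hA : A ≠ 0) (hC : C ≠ 0)
    (hF : ∀ k, 3 ≤ k → y k 0 * (A * y k 1 ^ 2 + B * (y k 1 * y k 2) + C * y k 2 ^ 2)
      + y k 1 * y k 2 * (α * y k 1 + β * y k 2) = 0) :
    A * β ^ 2 - B * (α * β) + C * α ^ 2 ≠ 0 := by
  intro hR
  by_cases hα : α = 0
  · have hβ : β = 0 := by simpa [hα, hA] using hR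
    -- Now `ℓ = 0`, and `q₂` would have the slopes of three of the points as roots.
    subst hα hβ
    have h0 : ∀ k : Fin 7, 3 ≤ k → y k 0 ≠ 0 := by
      intro k hk h
      have := hy.line 1 0 0 {1, 2, k} (by
        rw [Finset.card_eq_three.mpr ⟨1, 2, k, by decide, by grind, by grind, rfl⟩])
        (by simp [hy.one, hy.two, h])
      simp at this
    have hinj : Function.Injective (fun j : Fin 3 =>
        y (Fin.natAdd 4 j : Fin 7) 2 / y (Fin.natAdd 4 j : Fin 7) 1) := by
      intro j l hjl
      by_contra hne
      exact hy.slope_ne (by clear * -; revert j; decide) (by clear * -; revert l; decide)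
        (fun h => hne ((Fin.natAdd_inj 4).mp h)) hjl
    have := Matrix.eq_zero_of_forall_index_sum_pow_mul_eq_zero (v := ![A, B, C]) hinj (by
      intro j
      have h3 : (3 : Fin 7) ≤ Fin.natAdd 4 j := by revert j; decide
      generalize (Fin.natAdd 4 j : Fin 7) = k at h3
      have hx := hy.coord_one_ne_zero h3
      have := hF k h3
      simp only [zero_mul, add_zero, mul_zero, mul_eq_zero, h0 k h3, false_or] at this
      simp only [Fin.sum_univ_three, Matrix.cons_val, Fin.coe_ofNat_eq_mod]
      norm_num
      field_simp
      linear_combination this)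
    exact hA (congrFun this 0)
  have hβ : β ≠ 0 := by
    rintro rfl
    simp_all
  -- The cubic is `ℓ` times the conic below, which passes through the three basis points. The line
  -- has at most two of the seven points, one of them `[1 : 0 : 0]`, which is also on the conic; so
  -- the conic has at least six.
  let Tl : Finset (Fin 7) := {i | α * y i 1 + β * y i 2 = 0}
  let Tq : Finset (Fin 7) :=
    {i | A / α * (y i 0 * y i 1) + C / β * (y i 0 * y i 2) + y i 1 * y i 2 = 0}
  have hTl : Tl.card ≤ 2 := by
    by_contra! h
    have := hy.line 0 α β Tl h (by simp [Tl])
    exact hα this.2.1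
  have hTq : Tq.card ≤ 5 := by
    by_contra! h
    have := hy.conic 0 0 0 (A / α) (C / β) 1 Tq h (by simp [Tq])
    simp at this
  have hunion : Tl ∪ Tq = Finset.univ := by
    refine Finset.eq_univ_of_forall fun i => ?_
    simp only [Finset.mem_union, Tl, Tq, Finset.mem_filter, Finset.mem_univ, true_and]
    obtain rfl | rfl | rfl | h3 : i = 0 ∨ i = 1 ∨ i = 2 ∨ 3 ≤ i := by revert i; decide
    · simp [hy.zero]
    · simp [hy.one]
    · simp [hy.two]
    · rw [← mul_eq_zero]
      rw [← hF i h3]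
      field_simp
      linear_combination (y i 0 * y i 1 * y i 2) * hR
  have hinter : 1 ≤ (Tl ∩ Tq).card :=
    Finset.card_pos.mpr ⟨0, by simp [Tl, Tq, hy.zero]⟩
  have := Finset.card_union_add_card_inter Tl Tq
  rw [hunion, Finset.card_univ, Fintype.card_fin] at this
  omega

end IsGeneralFrame

/-! ### Intersecting two singular cubics -/

/-- Let `F = x₀ q₂ + x₁ x₂ ℓ` be singular at `[1 : 0 : 0]`, and let `G`, with coefficients
`m, n, b, c, d`, be singular at `[0 : 1 : 0]`. At a common zero `[r : 1 : t]` with `t ≠ 0`, solving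
`F = 0` for `r` and substituting into `G` leaves `t² / q₂²` times a quartic in `t`, which must
vanish. -/
theorem residual_quartic_eq_zero {A B C α β m n b c d r t : ℂ} (ht : t ≠ 0)
    (hR : A * β ^ 2 - B * (α * β) + C * α ^ 2 ≠ 0)
    (hF : r * (A + B * t + C * t ^ 2) + t * (α + β * t) = 0)
    (hG : r ^ 2 * (m + n * t) + r * (b * t + c * t ^ 2) + d * t ^ 2 = 0) :
    A + B * t + C * t ^ 2 ≠ 0 ∧
    (α + β * t) ^ 2 * (m + n * t) - (α + β * t) * (A + B * t + C * t ^ 2) * (b + c * t)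
      + d * (A + B * t + C * t ^ 2) ^ 2 = 0 := by
  constructor
  · intro h
    have h' : α + β * t = 0 := by simpa [h, ht] using hF
    apply hR
    linear_combination β ^ 2 * h - (B * β + C * (β * t - α)) * h'
  · have h : r * (A + B * t + C * t ^ 2) = -(t * (α + β * t)) := by linear_combination hF
    generalize hq : A + B * t + C * t ^ 2 = q at h ⊢
    apply mul_left_cancel₀ (pow_ne_zero 2 ht)
    linear_combination q ^ 2 * hG
      + ((m + n * t) * (t * (α + β * t) - r * q) - (b * t + c * t ^ 2) * q) * h

/-- If the quartic of `residual_quartic_eq_zero` has five roots then it is zero, and then all the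
coefficients of `G` are: as `q₂` and `ℓ` are coprime, `q₂` would have to divide the linear form
`m + n t`. -/
theorem residual_coeff_eq_zero {A B C α β m n b c d : ℂ} (hC : C ≠ 0)
    (hR : A * β ^ 2 - B * (α * β) + C * α ^ 2 ≠ 0) {t : Fin 5 → ℂ} (ht : Function.Injective t)
    (h : ∀ j, (α + β * t j) ^ 2 * (m + n * t j)
      - (α + β * t j) * (A + B * t j + C * t j ^ 2) * (b + c * t j)
      + d * (A + B * t j + C * t j ^ 2) ^ 2 = 0) :
    m = 0 ∧ n = 0 ∧ b = 0 ∧ c = 0 ∧ d = 0 := by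
  have hv := Matrix.eq_zero_of_forall_index_sum_pow_mul_eq_zero ht (v := ![
      α ^ 2 * m - α * b * A + d * A ^ 2,
      α ^ 2 * n + 2 * (α * β) * m - (α * b * B + (α * c + β * b) * A) + 2 * d * (A * B),
      2 * (α * β) * n + β ^ 2 * m - (α * b * C + (α * c + β * b) * B + β * c * A)
        + d * (B ^ 2 + 2 * (A * C)),
      β ^ 2 * n - ((α * c + β * b) * C + β * c * B) + 2 * d * (B * C),
      -(β * c * C) + d * C ^ 2]) (by
    intro j
    simp only [Fin.sum_univ_five, Matrix.cons_val, Fin.coe_ofNat_eq_mod]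
    norm_num
    linear_combination h j)
  have h0 := congrFun hv 0
  have h1 := congrFun hv 1
  have h2 := congrFun hv 2
  have h3 := congrFun hv 3
  have h4 := congrFun hv 4
  simp only [Matrix.cons_val, Pi.zero_apply] at h0 h1 h2 h3 h4
  -- If `β ≠ 0`, evaluating the quartic at the root `-α / β` of `ℓ` kills all but its last term.
  by_cases hβ : β = 0
  · subst hβ
    have hα : α ≠ 0 := by rintro rfl; simp at hR
    obtain rfl : d = 0 := by simpa [hC] using h4
    obtain rfl : c = 0 := by simpa [hC, hα] using h3
    obtain rfl : b = 0 := by simpa [hC, hα] using h2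
    simp_all
  · have hd : d * (A * β ^ 2 - B * (α * β) + C * α ^ 2) ^ 2 = 0 := by
      linear_combination β ^ 4 * h0 - α * β ^ 3 * h1 + α ^ 2 * β ^ 2 * h2 - α ^ 3 * β * h3
        + α ^ 4 * h4
    obtain rfl : d = 0 := by simpa [hR] using hd
    obtain rfl : c = 0 := by simpa [hC, hβ] using h4
    have e2 : β * n - C * b = 0 := by
      apply mul_left_cancel₀ hβ
      linear_combination h3
    have e1 : α * n + β * m - B * b = 0 := by
      apply mul_left_cancel₀ hβ
      linear_combination h2 - α * e2
    have e0 : α * m - A * b = 0 := by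
      apply mul_left_cancel₀ hβ
      linear_combination h1 - α * e1
    have hb : b * (A * β ^ 2 - B * (α * β) + C * α ^ 2) = 0 := by
      linear_combination α * β * e1 - β ^ 2 * e0 - α ^ 2 * e2
    obtain rfl : b = 0 := by simpa [hR] using hb
    obtain rfl : n = 0 := by simpa [hβ] using e2
    obtain rfl : m = 0 := by simpa [hβ] using e1
    simp

/-- Let `F` and `G` be nonzero cubics through the seven points, singular at the first and at the
second point respectively. Then they have no further common point: an eighth one would give the
quartic of `residual_quartic_eq_zero` a fifth root besides the slopes of the last four points. -/
theorem IsGeneralFrame.eq_smul_of_nodal_cubics {y : Fin 7 → Fin 3 → ℂ} (hy : IsGeneralFrame y)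
    {A B C α β m n b c d : ℂ} {v : Fin 3 → ℂ}
    (hFne : ¬ (A = 0 ∧ B = 0 ∧ C = 0 ∧ α = 0 ∧ β = 0))
    (hGne : ¬ (m = 0 ∧ n = 0 ∧ b = 0 ∧ c = 0 ∧ d = 0))
    (hFy : ∀ k, 3 ≤ k → y k 0 * (A * y k 1 ^ 2 + B * (y k 1 * y k 2) + C * y k 2 ^ 2)
      + y k 1 * y k 2 * (α * y k 1 + β * y k 2) = 0)
    (hGy : ∀ k, 3 ≤ k → y k 0 ^ 2 * (m * y k 1 + n * y k 2)
      + y k 0 * (b * (y k 1 * y k 2) + c * y k 2 ^ 2) + d * (y k 1 * y k 2 ^ 2) = 0)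
    (hF : v 0 * (A * v 1 ^ 2 + B * (v 1 * v 2) + C * v 2 ^ 2)
      + v 1 * v 2 * (α * v 1 + β * v 2) = 0)
    (hG : v 0 ^ 2 * (m * v 1 + n * v 2)
      + v 0 * (b * (v 1 * v 2) + c * v 2 ^ 2) + d * (v 1 * v 2 ^ 2) = 0) :
    ∃ k, ∃ s : ℂ, v = s • y k := by
  by_contra! hoff
  obtain ⟨hA, hC⟩ := hy.nodal_coeff_ne_zero hFne hFy
  have hR := hy.nodal_resultant_ne_zero hA hC hFy
  have hv1 : v 1 ≠ 0 := by
    intro h1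
    have : v 0 = 0 ∨ v 2 = 0 := by simpa [h1, hC] using hF
    obtain h | h := this
    · exact hoff 2 (v 2) (by ext i; fin_cases i <;> simp [hy.two, h, h1])
    · exact hoff 0 (v 0) (by ext i; fin_cases i <;> simp [hy.zero, h, h1])
  have hv2 : v 2 ≠ 0 := by
    intro h2
    have : v 0 = 0 ∨ v 1 = 0 := by simpa [h2, hA] using hF
    obtain h | h := this
    · exact hoff 1 (v 1) (by ext i; fin_cases i <;> simp [hy.one, h, h2])
    · exact hv1 h
  let w : Fin 5 → Fin 3 → ℂ := Fin.cons v fun j : Fin 4 => y (Fin.natAdd 3 j)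
  have h3 : ∀ j : Fin 4, (3 : Fin 7) ≤ Fin.natAdd 3 j := by decide
  have hw1 : ∀ j, w j 1 ≠ 0 := Fin.cases hv1 fun j => hy.coord_one_ne_zero (h3 j)
  have hw2 : ∀ j, w j 2 ≠ 0 := Fin.cases hv2 fun j => hy.coord_two_ne_zero (h3 j)
  have hwF0 : ∀ j, w j 0 * (A * w j 1 ^ 2 + B * (w j 1 * w j 2) + C * w j 2 ^ 2)
      + w j 1 * w j 2 * (α * w j 1 + β * w j 2) = 0 := Fin.cases hF fun j => hFy _ (h3 j)
  have hwG0 : ∀ j, w j 0 ^ 2 * (m * w j 1 + n * w j 2)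
      + w j 0 * (b * (w j 1 * w j 2) + c * w j 2 ^ 2) + d * (w j 1 * w j 2 ^ 2) = 0 :=
    Fin.cases hG fun j => hGy _ (h3 j)
  have hwF : ∀ j, w j 0 / w j 1 * (A + B * (w j 2 / w j 1) + C * (w j 2 / w j 1) ^ 2)
      + w j 2 / w j 1 * (α + β * (w j 2 / w j 1)) = 0 := by
    intro j
    have h := hwF0 j
    have := hw1 j
    field_simp
    linear_combination h
  have hwG : ∀ j, (w j 0 / w j 1) ^ 2 * (m + n * (w j 2 / w j 1))
      + w j 0 / w j 1 * (b * (w j 2 / w j 1) + c * (w j 2 / w j 1) ^ 2)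
      + d * (w j 2 / w j 1) ^ 2 = 0 := by
    intro j
    have h := hwG0 j
    have := hw1 j
    field_simp
    linear_combination h
  have hw := fun j => residual_quartic_eq_zero (div_ne_zero (hw2 j) (hw1 j)) hR (hwF j) (hwG j)
  -- `F` is linear in `x₀` with nonzero leading coefficient, so a line through the first point
  -- meets its zero set in only one other point.
  have hslope : ∀ i : Fin 4,
      v 2 / v 1 ≠ y (Fin.natAdd 3 i) 2 / y (Fin.natAdd 3 i) 1 := by
    intro i h
    have hq := (hw i.succ).1
    have hFi := hwF i.succ
    have hF0 := hwF 0
    simp only [w, Fin.cons_succ, Fin.cons_zero] at hq hFi hF0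
    rw [h] at hF0
    have hr := mul_right_cancel₀ hq (add_right_cancel (hF0.trans hFi.symm))
    have hy1 := hy.coord_one_ne_zero (h3 i)
    refine hoff (Fin.natAdd 3 i) (v 1 / y (Fin.natAdd 3 i) 1) ?_
    ext l
    fin_cases l
    · simp
      field_simp at hr ⊢
      linear_combination hr
    · simp
      field_simp
    · simp
      field_simp at h ⊢
      linear_combination h
  have hinj : Function.Injective fun j => w j 2 / w j 1 := by
    intro j
    refine Fin.cases ?_ (fun i => ?_) j <;> intro l <;> refine Fin.cases ?_ (fun k => ?_) l <;>
      intro h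
    · rfl
    · exact (hslope k h).elim
    · exact (hslope i h.symm).elim
    · by_contra hne
      exact hy.slope_ne (h3 i) (h3 k)
        (fun h' => hne (congrArg Fin.succ ((Fin.natAdd_inj 3).mp h'))) h
  obtain ⟨rfl, rfl, rfl, rfl, rfl⟩ := residual_coeff_eq_zero hC hR hinj fun j => (hw j).2
  simp at hGne

/-! ### The omitted value of a net of cubics -/

/-- The value at `v` of the ternary cubic with coefficients `c`, in the monomial order
`x₀³, x₁³, x₂³, x₀²x₁, x₀²x₂, x₀x₁², x₁²x₂, x₀x₂², x₁x₂², x₀x₁x₂`. -/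
def ternaryCubic (c : Fin 10 → ℂ) (v : Fin 3 → ℂ) : ℂ :=
  c 0 * v 0 ^ 3 + c 1 * v 1 ^ 3 + c 2 * v 2 ^ 3 + c 3 * (v 0 ^ 2 * v 1) + c 4 * (v 0 ^ 2 * v 2)
    + c 5 * (v 0 * v 1 ^ 2) + c 6 * (v 1 ^ 2 * v 2) + c 7 * (v 0 * v 2 ^ 2) + c 8 * (v 1 * v 2 ^ 2)
    + c 9 * (v 0 * v 1 * v 2)

theorem ternaryCubic_smul (c : Fin 10 → ℂ) (s : ℂ) (v : Fin 3 → ℂ) :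
    ternaryCubic c (s • v) = s ^ 3 * ternaryCubic c v := by
  simp only [ternaryCubic, Pi.smul_apply, smul_eq_mul]
  ring

theorem exists_ternaryCubic_eq_monomial (a : ℂ) {i j k : ℕ} (h : i + j + k = 3) :
    ∃ c, ∀ v, ternaryCubic c v = a * (v 0 ^ i * v 1 ^ j * v 2 ^ k) := by
  obtain rfl : k = 3 - i - j := by omega
  have hi : i ≤ 3 := by omega
  have hj : j ≤ 3 := by omega
  interval_cases i <;> interval_cases j <;> try omega
  · exact ⟨Pi.single 2 a, fun v => by simp [ternaryCubic]⟩
  · exact ⟨Pi.single 8 a, fun v => by simp [ternaryCubic]⟩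
  · exact ⟨Pi.single 6 a, fun v => by simp [ternaryCubic]⟩
  · exact ⟨Pi.single 1 a, fun v => by simp [ternaryCubic]⟩
  · exact ⟨Pi.single 7 a, fun v => by simp [ternaryCubic]⟩
  · exact ⟨Pi.single 9 a, fun v => by simp [ternaryCubic]⟩
  · exact ⟨Pi.single 5 a, fun v => by simp [ternaryCubic]⟩
  · exact ⟨Pi.single 4 a, fun v => by simp [ternaryCubic]⟩
  · exact ⟨Pi.single 3 a, fun v => by simp [ternaryCubic]⟩
  · exact ⟨Pi.single 0 a, fun v => by simp [ternaryCubic]⟩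

theorem eval_eq_ternaryCubic {F : Form} (hF : F.IsHomogeneous 3) :
    ∃ c, ∀ v, MvPolynomial.eval v F = ternaryCubic c v := by
  rw [F.as_sum]
  refine Finset.sum_induction _ (fun F : Form => ∃ c, ∀ v, MvPolynomial.eval v F = ternaryCubic c v)
    ?_ ?_ ?_
  · rintro F G ⟨c, hc⟩ ⟨c', hc'⟩
    refine ⟨c + c', fun v => ?_⟩
    rw [map_add, hc, hc']
    simp only [ternaryCubic, Pi.add_apply]
    ring
  · exact ⟨0, fun v => by simp [ternaryCubic]⟩
  · intro e he
    have hdeg : e 0 + e 1 + e 2 = 3 := by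
      have := Finsupp.degree_eq_weight_one (R := ℕ) ▸ hF (MvPolynomial.mem_support_iff.mp he)
      rwa [Finsupp.degree_eq_sum, Fin.sum_univ_three] at this
    obtain ⟨c, hc⟩ := exists_ternaryCubic_eq_monomial (MvPolynomial.coeff e F) hdeg
    refine ⟨c, fun v => ?_⟩
    rw [hc, MvPolynomial.eval_monomial, Finsupp.prod_fintype _ _ fun _ => pow_zero _,
      Fin.prod_univ_three]

theorem exists_ne_zero_orthogonal_pair (u w : Fin 3 → ℂ) :
    ∃ a : Fin 3 → ℂ, a ≠ 0 ∧ u ⬝ᵥ a = 0 ∧ w ⬝ᵥ a = 0 := by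
  obtain ⟨a, ha, h⟩ := Matrix.exists_mulVec_eq_zero_iff.mpr
    (Matrix.det_zero_of_row_eq (M := Matrix.of ![u, w, w]) (i := 1) (j := 2) (by decide) rfl)
  exact ⟨a, ha, congrFun h 0, congrFun h 1⟩

theorem dotProduct_ternaryCubic (a : Fin 3 → ℂ) (c : Fin 3 → Fin 10 → ℂ) (v : Fin 3 → ℂ) :
    (a ⬝ᵥ fun i => ternaryCubic (c i) v) = ternaryCubic (fun j => a ⬝ᵥ fun i => c i j) v := by
  simp only [dotProduct, Fin.sum_univ_three, ternaryCubic]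
  ring

/-- A net of cubics through the seven points omits a value `[q]`. Choose members `a`, `b` of the net
singular at the first and at the second point, and `q` on both of the lines `a` and `b` of the
target plane. -/
theorem IsGeneralFrame.exists_omitted_direction {y : Fin 7 → Fin 3 → ℂ} (hy : IsGeneralFrame y)
    (c : Fin 3 → Fin 10 → ℂ) (hvanish : ∀ i k, ternaryCubic (c i) (y k) = 0)
    (hindep : ∀ a : Fin 3 → ℂ, a ≠ 0 → ∃ v, (a ⬝ᵥ fun i => ternaryCubic (c i) v) ≠ 0) :
    ∃ q : Fin 3 → ℂ, q ≠ 0 ∧ ∀ v, ∀ s : ℂ, (fun i => ternaryCubic (c i) v) = s • q →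
      (fun i => ternaryCubic (c i) v) = 0 := by
  obtain ⟨a, ha, ha3, ha4⟩ := exists_ne_zero_orthogonal_pair (c · 3) (c · 4)
  obtain ⟨b, hb, hb5, hb6⟩ := exists_ne_zero_orthogonal_pair (c · 5) (c · 6)
  obtain ⟨q, hq, hqa, hqb⟩ := exists_ne_zero_orthogonal_pair a b
  refine ⟨q, hq, fun v s hv => ?_⟩
  have hc0 : ∀ i, c i 0 = 0 := fun i => by simpa [hy.zero, ternaryCubic] using hvanish i 0
  have hc1 : ∀ i, c i 1 = 0 := fun i => by simpa [hy.one, ternaryCubic] using hvanish i 1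
  have hc2 : ∀ i, c i 2 = 0 := fun i => by simpa [hy.two, ternaryCubic] using hvanish i 2
  rw [dotProduct_comm] at ha3 ha4 hb5 hb6
  -- Only the monomials occurring in `IsGeneralFrame.eq_smul_of_nodal_cubics` survive: the cubes
  -- vanish because of the basis points, the others by the choice of `a` and `b`.
  obtain ⟨va, hva⟩ := hindep a ha
  obtain ⟨vb, hvb⟩ := hindep b hb
  rw [dotProduct_ternaryCubic] at hva hvb
  have hFv : ∀ k, ternaryCubic (fun j => a ⬝ᵥ fun i => c i j) (y k) = 0 := fun k => by
    rw [← dotProduct_ternaryCubic]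
    simp [hvanish, dotProduct]
  have hGv : ∀ k, ternaryCubic (fun j => b ⬝ᵥ fun i => c i j) (y k) = 0 := fun k => by
    rw [← dotProduct_ternaryCubic]
    simp [hvanish, dotProduct]
  have hF : ternaryCubic (fun j => a ⬝ᵥ fun i => c i j) v = 0 := by
    rw [← dotProduct_ternaryCubic, hv, dotProduct_smul, hqa, smul_zero]
  have hG : ternaryCubic (fun j => b ⬝ᵥ fun i => c i j) v = 0 := by
    rw [← dotProduct_ternaryCubic, hv, dotProduct_smul, hqb, smul_zero]
  have hz : ∀ (e : Fin 3 → ℂ) (j : Fin 10), (∀ i, c i j = 0) → (e ⬝ᵥ fun i => c i j) = 0 :=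
    fun e j h => by simp [h, dotProduct]
  simp only [ternaryCubic, hz _ _ hc0, hz _ _ hc1, hz _ _ hc2, ha3, ha4, hb5, hb6, zero_mul,
    zero_add] at hva hvb hFv hGv hF hG
  obtain ⟨k, r, hk⟩ := hy.eq_smul_of_nodal_cubics (v := v)
    (A := a ⬝ᵥ fun i => c i 5) (B := a ⬝ᵥ fun i => c i 9) (C := a ⬝ᵥ fun i => c i 7)
    (α := a ⬝ᵥ fun i => c i 6) (β := a ⬝ᵥ fun i => c i 8)
    (m := b ⬝ᵥ fun i => c i 3) (n := b ⬝ᵥ fun i => c i 4) (b := b ⬝ᵥ fun i => c i 9)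
    (c := b ⬝ᵥ fun i => c i 7) (d := b ⬝ᵥ fun i => c i 8)
    (by rintro ⟨h5, h9, h7, h6, h8⟩; simp [h5, h6, h7, h8, h9] at hva)
    (by rintro ⟨h3, h4, h9, h7, h8⟩; simp [h3, h4, h7, h8, h9] at hvb)
    (fun k _ => by linear_combination hFv k)
    (fun k _ => by linear_combination hGv k)
    (by linear_combination hF) (by linear_combination hG)
  subst hk
  funext i
  simp [ternaryCubic_smul, hvanish]

/-! ### Change of coordinates -/

open MvPolynomial in
/-- The form `F ∘ N` obtained from `F` by the linear substitution with matrix `N`. -/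
noncomputable def Form.substitute (N : Matrix (Fin 3) (Fin 3) ℂ) (F : Form) : Form :=
  bind₁ (fun i => ∑ j, C (N i j) * X j) F

theorem Form.eval_substitute (N : Matrix (Fin 3) (Fin 3) ℂ) (F : Form) (v : Fin 3 → ℂ) :
    MvPolynomial.eval v (F.substitute N) = MvPolynomial.eval (N.mulVec v) F := by
  simp only [Form.substitute, MvPolynomial.eval, MvPolynomial.eval₂Hom_bind₁]
  congr 2
  ext i
  simp [Matrix.mulVec, dotProduct]

theorem Form.isHomogeneous_substitute (N : Matrix (Fin 3) (Fin 3) ℂ) {F : Form} {d : ℕ}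
    (hF : F.IsHomogeneous d) : (F.substitute N).IsHomogeneous d := by
  have := hF.aeval (fun i => ∑ j, MvPolynomial.C (N i j) * MvPolynomial.X j) (n := 1)
    fun i => MvPolynomial.IsHomogeneous.sum _ _ _ fun j _ => by
      simpa using (MvPolynomial.isHomogeneous_C (Fin 3) (N i j)).mul (MvPolynomial.isHomogeneous_X ℂ j)
  simpa [Form.substitute] using this

open MvPolynomial in
/-- Taking three of the points as the coordinate points, seven points in general position become a
general frame. -/
theorem InGeneralPosition.isGeneralFrame {S : Set Plane} (hS : InGeneralPosition S)
    (p : Fin 7 ↪ Plane) (hp : ∀ k, p k ∈ S) :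
    ∃ N : Matrix (Fin 3) (Fin 3) ℂ, IsUnit N.det ∧
      ∃ y : Fin 7 → Fin 3 → ℂ, IsGeneralFrame y ∧ ∀ k, N.mulVec (y k) = (p k).rep := by
  have hcount : ∀ (F : Form) (T : Finset (Fin 7)), (∀ k ∈ T, F.VanishesAt (p k)) →
      (T.card : ℕ∞) ≤ {q ∈ S | F.VanishesAt q}.encard := by
    intro F T hT
    rw [← Finset.card_map p, ← Set.encard_coe_eq_coe_finsetCard]
    refine Set.encard_le_encard ?_
    intro q hq
    obtain ⟨k, hk, rfl⟩ := Finset.mem_map.mp (Finset.mem_coe.mp hq)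
    exact ⟨hp k, hT k hk⟩
  let N : Matrix (Fin 3) (Fin 3) ℂ := Matrix.of fun i j => (p (Fin.castAdd 4 j)).rep i
  have hdet : IsUnit N.det := by
    rw [isUnit_iff_ne_zero]
    intro h0
    obtain ⟨l, hl, hlN⟩ := Matrix.exists_vecMul_eq_zero_iff.mpr h0
    have hL : ∀ v : Fin 3 → ℂ, eval v (∑ j, C (l j) * X j : Form) = l ⬝ᵥ v := fun v => by
      simp [dotProduct]
    have h3 := (hcount _ {0, 1, 2} (by
      have h : ∀ j : Fin 3, (∑ j, C (l j) * X j : Form).VanishesAt (p (Fin.castAdd 4 j)) :=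
        fun j => (hL _).trans (congrFun hlN j)
      simpa using ⟨h 0, h 1, h 2⟩)).trans (hS.1 (∑ j, C (l j) * X j) (by
        intro h
        apply hl
        funext j
        have := hL (Pi.single j 1)
        rw [h] at this
        simpa using this.symm) (IsHomogeneous.sum _ _ _ fun j _ => by
          simpa using (isHomogeneous_C (Fin 3) (l j)).mul (isHomogeneous_X ℂ j)))
    exact absurd h3 (by decide)
  refine ⟨N, hdet, fun k => N⁻¹.mulVec (p k).rep, ?_, fun k => by
    rw [Matrix.mulVec_mulVec, Matrix.mul_nonsing_inv _ hdet, Matrix.one_mulVec]⟩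
  have hstd : ∀ j, N⁻¹.mulVec (p (Fin.castAdd 4 j)).rep = Pi.single j 1 := fun j => by
    have : (p (Fin.castAdd 4 j)).rep = N.mulVec (Pi.single j 1) := by
      rw [Matrix.mulVec_single_one]; rfl
    rw [this, Matrix.mulVec_mulVec, Matrix.nonsing_inv_mul _ hdet, Matrix.one_mulVec]
  -- A form vanishing at too many of the frame vectors is zero, since its transform back to the
  -- original coordinates vanishes at the points themselves.
  have htransform : ∀ (F : Form) (d : ℕ) (b : ℕ) (T : Finset (Fin 7)), F.IsHomogeneous d →
      (∀ G : Form, G ≠ 0 → G.IsHomogeneous d → {q ∈ S | G.VanishesAt q}.encard ≤ b) →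
      b < T.card → (∀ k ∈ T, eval (N⁻¹.mulVec (p k).rep) F = 0) → ∀ v, eval v F = 0 := by
    intro F d b T hF hb hT hvan v
    have h0 : F.substitute N⁻¹ = 0 := by
      by_contra hne
      have := (hcount (F.substitute N⁻¹) T fun k hk =>
        (Form.eval_substitute _ _ _).trans (hvan k hk)).trans
          (hb _ hne (Form.isHomogeneous_substitute _ hF))
      exact absurd (Nat.cast_le.mp this) (by omega)
    have := Form.eval_substitute N⁻¹ F (N.mulVec v)
    rwa [h0, map_zero, Matrix.mulVec_mulVec, Matrix.nonsing_inv_mul _ hdet, Matrix.one_mulVec,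
      eq_comm] at this
  have hCX : ∀ (a : ℂ) (G : Form) (d : ℕ), G.IsHomogeneous d → (C a * G).IsHomogeneous d :=
    fun a G d hG => by simpa using (isHomogeneous_C (Fin 3) a).mul hG
  have hX := isHomogeneous_X (σ := Fin 3) ℂ
  constructor
  · rw [show ![1, 0, 0] = Pi.single (0 : Fin 3) (1 : ℂ) by ext i; fin_cases i <;> rfl]
    exact hstd 0
  · rw [show ![0, 1, 0] = Pi.single (1 : Fin 3) (1 : ℂ) by ext i; fin_cases i <;> rfl]
    exact hstd 1
  · rw [show ![0, 0, 1] = Pi.single (2 : Fin 3) (1 : ℂ) by ext i; fin_cases i <;> rfl]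
    exact hstd 2
  · intro l₀ l₁ l₂ T hT h
    have := htransform (C l₀ * X 0 + C l₁ * X 1 + C l₂ * X 2) 1 2 T
      (((hCX _ _ _ (hX 0)).add (hCX _ _ _ (hX 1))).add (hCX _ _ _ (hX 2))) hS.1 hT
      (fun k hk => by simpa using h k hk)
    exact ⟨by simpa using this ![1, 0, 0], by simpa using this ![0, 1, 0],
      by simpa using this ![0, 0, 1]⟩
  · intro q₀₀ q₁₁ q₂₂ q₀₁ q₀₂ q₁₂ T hT h
    have := htransform (C q₀₀ * X 0 ^ 2 + C q₁₁ * X 1 ^ 2 + C q₂₂ * X 2 ^ 2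
        + C q₀₁ * (X 0 * X 1) + C q₀₂ * (X 0 * X 2) + C q₁₂ * (X 1 * X 2)) 2 5 T
      ((((((hCX _ _ _ ((hX 0).pow 2)).add (hCX _ _ _ ((hX 1).pow 2))).add
        (hCX _ _ _ ((hX 2).pow 2))).add (hCX _ _ _ ((hX 0).mul (hX 1)))).add
        (hCX _ _ _ ((hX 0).mul (hX 2)))).add (hCX _ _ _ ((hX 1).mul (hX 2)))) hS.2 hT
      (fun k hk => by simpa using h k hk)
    have e0 : q₀₀ = 0 := by simpa using this ![1, 0, 0]
    have e1 : q₁₁ = 0 := by simpa using this ![0, 1, 0]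
    have e2 : q₂₂ = 0 := by simpa using this ![0, 0, 1]
    exact ⟨e0, e1, e2, by simpa [e0, e1] using this ![1, 1, 0],
      by simpa [e0, e2] using this ![1, 0, 1], by simpa [e1, e2] using this ![0, 1, 1]⟩

/-! ### Non-surjectivity -/

/-- The components of a surjective endomorphism are linearly independent: otherwise the image would
lie on a line. -/
theorem RationalEndo.IsSurjective.exists_dotProduct_ne_zero {d : ℕ} {f : RationalEndo d}
    (hf : f.IsSurjective) {a : Fin 3 → ℂ} (ha : a ≠ 0) :
    ∃ v, (a ⬝ᵥ fun i => MvPolynomial.eval v (f.comp i)) ≠ 0 := by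
  obtain ⟨i, hi⟩ := Function.ne_iff.mp ha
  obtain ⟨x, hx⟩ := hf (Projectivization.mk ℂ (Pi.single i 1) (by simp))
  rw [toMap, Projectivization.mk_eq_mk_iff'] at hx
  obtain ⟨s, hs⟩ := hx
  refine ⟨x.1.rep, fun h => ?_⟩
  have hs0 : s ≠ 0 := by
    rintro rfl
    exact f.value_ne_zero x (by simpa using hs.symm)
  rw [← hs, dotProduct_smul] at h
  simp [hs0] at h
  exact hi h

theorem corollary2p2 (f : RationalEndo 3)
    (hcard : 7 ≤ f.indeterminacyLocus.encard)
    (hgen : InGeneralPosition f.indeterminacyLocus) :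
    ¬ f.IsSurjective := by
  intro hsurj
  obtain ⟨P, hPS, hP⟩ := Set.exists_subset_encard_eq hcard
  have hfin : P.Finite := Set.finite_of_encard_eq_coe hP
  obtain ⟨p, rfl⟩ : ∃ p : Fin 7 ↪ Plane, Set.range p = P := by
    have hP7 : Nat.card P = 7 := by
      rw [Nat.card_coe_set_eq, Set.ncard, hP]
      rfl
    have := hfin.to_subtype
    let e : Fin 7 ≃ P := (Finite.equivFinOfCardEq hP7).symm
    exact ⟨e.toEmbedding.trans (Function.Embedding.subtype _),
      (e.surjective.range_comp Subtype.val).trans Subtype.range_coe⟩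
  obtain ⟨N, hN, y, hy, hyp⟩ := hgen.isGeneralFrame p fun k => hPS ⟨k, rfl⟩
  choose c hc using fun i => eval_eq_ternaryCubic
    (Form.isHomogeneous_substitute N (f.homogeneous i))
  simp only [Form.eval_substitute] at hc
  obtain ⟨q, hq, hmiss⟩ := hy.exists_omitted_direction c
    (fun i k => by
      rw [← hc, hyp]
      exact hPS ⟨k, rfl⟩ i)
    (fun a ha => by
      obtain ⟨v, hv⟩ := hsurj.exists_dotProduct_ne_zero ha
      refine ⟨N⁻¹.mulVec v, ?_⟩
      simpa only [← hc, Matrix.mulVec_mulVec, Matrix.mul_nonsing_inv _ hN, Matrix.one_mulVec]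
        using hv)
  obtain ⟨x, hx⟩ := hsurj (Projectivization.mk ℂ q hq)
  rw [RationalEndo.toMap, Projectivization.mk_eq_mk_iff'] at hx
  obtain ⟨s, hs⟩ := hx
  have hcx : (fun i => ternaryCubic (c i) (N⁻¹.mulVec x.1.rep))
      = fun i => MvPolynomial.eval x.1.rep (f.comp i) := by
    funext i
    rw [← hc, Matrix.mulVec_mulVec, Matrix.mul_nonsing_inv _ hN, Matrix.one_mulVec]
  exact f.value_ne_zero x (hcx ▸ hmiss _ s (hcx.trans hs.symm))
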